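/- **Theorem 3.1.** All manifolds are smooth, finite-dimensional and without boundary. For a smooth map $F:(M,g)\to(N,h)$ of Riemannian manifolds let $F_*$ be its differential, $\mathcal H_p=(\ker F_{*p})^\perp$ the horizontal space at $p\in M$, and $(\nabla F_*)(X,Y)=\nabla^F_X(F_*Y)-F_*(\nabla^M_XY)$ its second fundamental form, where $\nabla^M$ is the Levi-Civita connection of $M$ and $\nabla^F$ is the pullback along $F$ of the Levi-Civita connection of $N$. * $F$ is a *Riemannian map* if it has constant rank $\operatorname{rank}F>0$ and $h(F_*X,F_*Y)=g(X,Y)$ for all $p\in M$ and $X,Y\in\mathcal H_p$. It is a *Riemannian submersion* if every $F_{*p}$ is onto and this equation holds for all $X,Y\in\mathcal H_p$, and an *isometric immersion* if every $F_{*p}$ is injective and the equation holds for all $X,Y\in T_pM$. * For $F$ a Riemannian map or an isometric immersion, of positive rank, the mean curvature vector field of $F$ is the vector field along $F$ given by $H_F=\frac1{\operatorname{rank}F}\sum_i(\nabla F_*)(e_i,e_i)$, where $(e_i)$ is an orthonormal basis of $\mathcal H_p$. For a section $V$ of $(\operatorname{range}F_*)^\perp$ along $F$ and $X\in\mathcal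 H_p$, let $A_VF_*X$ be minus the orthogonal projection of $\nabla^F_XV$ onto $\operatorname{range}F_{*p}$. Then $F$ is *pseudo-umbilical* if there is $\lambda\in C^\infty(M)$ such that $A_{H_F}F_*X=\lambda(p)\,F_*X$ for all $p\in M$ and $X\in\mathcal H_p$. Let $(M_1,g_1)$, $(M_2,g_2)$, $(M_3,g_3)$ be Riemannian manifolds with $\dim M_2\ge 1$, let $F_1:M_1\to M_2$ be a Riemannian submersion, and let $F_2:M_2\to M_3$ be a pseudo-umbilical isometric immersion. Then $F_2\circ F_1:M_1\to M_3$ is a pseudo-umbilical Riemannian map. -/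

import Mathlib

open scoped Bundle Manifold ContDiff

namespace RiemannianMap

noncomputable section

/-- The tangent spaces of a finite-dimensional manifold are finite-dimensional. -/
instance instFiniteDimensionalTangentSpace
    {E : Type*} [NormedAddCommGroup E] [NormedSpace ℝ E] [FiniteDimensional ℝ E]
    {M : Type*} [TopologicalSpace M] [ChartedSpace E M] (x : M) :
    FiniteDimensional ℝ (TangentSpace 𝓘(ℝ, E) x) :=
  inferInstanceAs (FiniteDimensional ℝ E)

section LeviCivita

variable {E : Type*} [NormedAddCommGroup E] [NormedSpace ℝ E] [FiniteDimensional ℝ E]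
  {N : Type*} [TopologicalSpace N] [ChartedSpace E N] [IsManifold 𝓘(ℝ, E) ∞ N]
  [Bundle.RiemannianBundle (fun y : N ↦ TangentSpace 𝓘(ℝ, E) y)]

/-- The field near `y` that extends `v ∈ T_y N` with constant components in the chart at `y`,
that is `∑ i, vⁱ ∂ᵢ`. -/
def coordField {y : N} (v : TangentSpace 𝓘(ℝ, E) y) : ∀ z : N, TangentSpace 𝓘(ℝ, E) z :=
  FiberBundle.extend E v

/-- The right-hand side of the Koszul formula for the coordinate fields `U, V, W` extending
`u, v, w ∈ T_y N` (the Lie brackets of coordinate fields vanish):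
`½ (U⟨V, W⟩ + V⟨U, W⟩ - W⟨U, V⟩)` at `y`. -/
def koszul (y : N) (u v w : TangentSpace 𝓘(ℝ, E) y) : ℝ :=
  (1 / 2 : ℝ) *
    (mvfderiv 𝓘(ℝ, E) (fun z : N ↦ inner ℝ (coordField v z) (coordField w z)) y u
      + mvfderiv 𝓘(ℝ, E) (fun z : N ↦ inner ℝ (coordField u z) (coordField w z)) y v
      - mvfderiv 𝓘(ℝ, E) (fun z : N ↦ inner ℝ (coordField u z) (coordField v z)) y w)

/-- The Christoffel symbols of the Levi-Civita connection at `y` in the chart at `y`: the vector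
`Γ(u, v) = ∇_u V`, for `V` the coordinate field extending `v`. It is the vector whose scalar product
with each `w` is `koszul y u v w`, written in an orthonormal basis of `T_y N`. -/
def christoffel (y : N) (u v : TangentSpace 𝓘(ℝ, E) y) : TangentSpace 𝓘(ℝ, E) y :=
  ∑ i, koszul y u v (stdOrthonormalBasis ℝ (TangentSpace 𝓘(ℝ, E) y) i) •
    stdOrthonormalBasis ℝ (TangentSpace 𝓘(ℝ, E) y) i

end LeviCivita

section Maps

variable (E : Type*) [NormedAddCommGroup E] [NormedSpace ℝ E] [FiniteDimensional ℝ E]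
  {M : Type*} [TopologicalSpace M] [ChartedSpace E M] [IsManifold 𝓘(ℝ, E) ∞ M]
  [Bundle.RiemannianBundle (fun x : M ↦ TangentSpace 𝓘(ℝ, E) x)]
  (E' : Type*) [NormedAddCommGroup E'] [NormedSpace ℝ E'] [FiniteDimensional ℝ E']
  {N : Type*} [TopologicalSpace N] [ChartedSpace E' N] [IsManifold 𝓘(ℝ, E') ∞ N]
  [Bundle.RiemannianBundle (fun y : N ↦ TangentSpace 𝓘(ℝ, E') y)]

/-- The pullback along `F : M → N` of the Levi-Civita connection of `N`: the derivative
`∇^F_X V ∈ T_{F p} N` of a vector field `V` along `F` (a section of `F⁻¹TN`) in the direction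
`X ∈ T_p M`. In the chart of `N` at `F p` it is `X(V^γ) + Γ^γ_{αβ} (F_* X)^α V^β`. -/
def covDerivAlong (F : M → N) (V : ∀ q : M, TangentSpace 𝓘(ℝ, E') (F q))
    (p : M) (X : TangentSpace 𝓘(ℝ, E) p) : TangentSpace 𝓘(ℝ, E') (F p) :=
  (trivializationAt E' (TangentSpace 𝓘(ℝ, E') : N → Type _) (F p)).symm (F p)
      (mvfderiv 𝓘(ℝ, E) (fun q : M ↦
        (trivializationAt E' (TangentSpace 𝓘(ℝ, E') : N → Type _) (F p) ⟨F q, V q⟩).2) p X)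
    + christoffel (F p) (mfderiv 𝓘(ℝ, E) 𝓘(ℝ, E') F p X) (V p)

/-- The Levi-Civita connection of `M`: `leviCivita Y p X = (∇_X Y)(p)` for a vector field `Y` and
`X ∈ T_p M`. It is the covariant derivative along the identity map. -/
def leviCivita (Y : ∀ q : M, TangentSpace 𝓘(ℝ, E) q) (p : M) (X : TangentSpace 𝓘(ℝ, E) p) :
    TangentSpace 𝓘(ℝ, E) p :=
  covDerivAlong E E (id : M → M) Y p X

/-- The vector field `F_* Y` along `F`. -/
def pushField (F : M → N) (Y : ∀ q : M, TangentSpace 𝓘(ℝ, E) q) :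
    ∀ q : M, TangentSpace 𝓘(ℝ, E') (F q) :=
  fun q ↦ mfderiv 𝓘(ℝ, E) 𝓘(ℝ, E') F q (Y q)

/-- The second fundamental form `(∇F_*)(X, Y) = ∇^F_X (F_* Y) - F_* (∇_X Y)` of `F` at `p`, for
`X, Y ∈ T_p M`. It is tensorial, so `Y` may be extended by the coordinate field. -/
def secondFundamentalForm (F : M → N) (p : M) (X Y : TangentSpace 𝓘(ℝ, E) p) :
    TangentSpace 𝓘(ℝ, E') (F p) :=
  covDerivAlong E E' F (pushField E E' F (coordField Y)) p X
    - mfderiv 𝓘(ℝ, E) 𝓘(ℝ, E') F p (leviCivita E (coordField Y) p X)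

/-- `range F_*` at `p`, a subspace of `T_{F p} N`. -/
def rangeSpace (F : M → N) (p : M) : Submodule ℝ (TangentSpace 𝓘(ℝ, E') (F p)) :=
  (mfderiv 𝓘(ℝ, E) 𝓘(ℝ, E') F p).range

/-- The horizontal space `(ker F_*)ᗮ` at `p`. -/
def horizontalSpace (F : M → N) (p : M) : Submodule ℝ (TangentSpace 𝓘(ℝ, E) p) :=
  ((mfderiv 𝓘(ℝ, E) 𝓘(ℝ, E') F p).ker)ᗮ

/-- The mean curvature vector field `H₂ = (1 / rank F) ∑ i, (∇F_*)(eᵢ, eᵢ)` of `range F_*`, a vector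
field along `F`; here `(eᵢ)` is an orthonormal basis of the horizontal space. -/
def meanCurvature (F : M → N) (p : M) : TangentSpace 𝓘(ℝ, E') (F p) :=
  (Module.finrank ℝ (rangeSpace E E' F p) : ℝ)⁻¹ •
    ∑ i, secondFundamentalForm E E' F p (stdOrthonormalBasis ℝ (horizontalSpace E E' F p) i)
      (stdOrthonormalBasis ℝ (horizontalSpace E E' F p) i)

/-- The shape operator, as a map of `X`: `A_V F_* X` is minus the component of `∇^F_X V` tangent to
`range F_*`, for a section `V` of `(range F_*)ᗮ` along `F`. -/
def shapeOperator (F : M → N) (V : ∀ q : M, TangentSpace 𝓘(ℝ, E') (F q))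
    (p : M) (X : TangentSpace 𝓘(ℝ, E) p) : TangentSpace 𝓘(ℝ, E') (F p) :=
  -((rangeSpace E E' F p).starProjection (covDerivAlong E E' F V p X))

/-- A Riemannian map: a smooth map of constant positive rank whose differential is isometric on the
horizontal spaces. -/
structure IsRiemannianMap (F : M → N) : Prop where
  smooth : ContMDiff 𝓘(ℝ, E) 𝓘(ℝ, E') ∞ F
  rank_pos : ∃ r : ℕ, 0 < r ∧ ∀ p : M, Module.finrank ℝ (rangeSpace E E' F p) = r
  isometry : ∀ p : M, ∀ X ∈ horizontalSpace E E' F p, ∀ Y ∈ horizontalSpace E E' F p,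
    inner ℝ (mfderiv 𝓘(ℝ, E) 𝓘(ℝ, E') F p X) (mfderiv 𝓘(ℝ, E) 𝓘(ℝ, E') F p Y) = inner ℝ X Y

/-- A Riemannian submersion: a smooth map whose differential is onto and isometric on the
horizontal spaces. -/
structure IsRiemannianSubmersion (F : M → N) : Prop where
  smooth : ContMDiff 𝓘(ℝ, E) 𝓘(ℝ, E') ∞ F
  surjective : ∀ p : M, Function.Surjective (mfderiv 𝓘(ℝ, E) 𝓘(ℝ, E') F p)
  isometry : ∀ p : M, ∀ X ∈ horizontalSpace E E' F p, ∀ Y ∈ horizontalSpace E E' F p,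
    inner ℝ (mfderiv 𝓘(ℝ, E) 𝓘(ℝ, E') F p X) (mfderiv 𝓘(ℝ, E) 𝓘(ℝ, E') F p Y) = inner ℝ X Y

/-- An isometric immersion: a smooth map whose differential is injective and isometric. -/
structure IsIsometricImmersion (F : M → N) : Prop where
  smooth : ContMDiff 𝓘(ℝ, E) 𝓘(ℝ, E') ∞ F
  injective : ∀ p : M, Function.Injective (mfderiv 𝓘(ℝ, E) 𝓘(ℝ, E') F p)
  isometry : ∀ (p : M) (X Y : TangentSpace 𝓘(ℝ, E) p),
    inner ℝ (mfderiv 𝓘(ℝ, E) 𝓘(ℝ, E') F p X) (mfderiv 𝓘(ℝ, E) 𝓘(ℝ, E') F p Y) = inner ℝ X Y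

/-- There is a smooth function `λ` on `M` with `A_{H₂} F_* X = λ F_* X` for all horizontal `X`. -/
def IsPseudoUmbilical (F : M → N) : Prop :=
  ∃ l : M → ℝ, ContMDiff 𝓘(ℝ, E) 𝓘(ℝ, ℝ) ∞ l ∧
    ∀ p : M, ∀ X ∈ horizontalSpace E E' F p,
      shapeOperator E E' F (meanCurvature E E' F) p X = l p • mfderiv 𝓘(ℝ, E) 𝓘(ℝ, E') F p X

/-- A pseudo-umbilical Riemannian map. -/
def IsPseudoUmbilicalRiemannianMap (F : M → N) : Prop :=
  IsRiemannianMap E E' F ∧ IsPseudoUmbilical E E' F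

/-- A pseudo-umbilical isometric immersion: `A_H = λ I` for the mean curvature vector field `H`.
For an immersion the horizontal space is the whole tangent space and `rank F = dim M`. -/
def IsPseudoUmbilicalIsometricImmersion (F : M → N) : Prop :=
  IsIsometricImmersion E E' F ∧ IsPseudoUmbilical E E' F

end Maps

end

end RiemannianMap

/-!
# Pseudo-umbilicity of an isometric immersion after a Riemannian submersion

Let `F : M → N` be a Riemannian submersion and `G : N → P` a pseudo-umbilical isometric immersion.
The differential of `G` is injective, so `G ∘ F` has the horizontal spaces of `F`, and the
differential of `F` is onto, so the range of `(G ∘ F)_*` at `p` is that of `G_*` at `F p`. Hence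
`G ∘ F` is a Riemannian map of rank `dim N`, and it remains to compare mean curvatures and shape
operators.

The second fundamental form obeys the composition law
`∇(G ∘ F)_* (X, Y) = ∇G_* (F_* X, F_* Y) + G_* (∇F_* (X, Y))` (`secondFundamentalForm_comp`), and
that of a Riemannian submersion vanishes on horizontal vectors
(`IsRiemannianSubmersion.secondFundamentalForm_eq_zero`). As `F_*` carries an orthonormal basis of
the horizontal space at `p` to one of `T_{F p} N`, and a trace does not depend on the orthonormal
basis, the mean curvature field of `G ∘ F` is `H_G ∘ F` (`meanCurvature_comp`). Its covariant
derivative in the direction `X` is that of `H_G` in the direction `F_* X` (`covDerivAlong_comp`),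
for which smoothness of `H_G` need not be checked (`mvfderiv_comp_of_surjective`). So
`A_{H_G} = λ` on `N` gives `A_{H_{G ∘ F}} = λ ∘ F` on `M`.

The vanishing on horizontal vectors is proved without horizontal lifts. For a horizontal `Y` at `p`,
extended by its coordinate field, the function `|Y|² - |F_* Y|²` is nonnegative and vanishes at `p`,
because `F_*` is isometric on horizontal vectors and kills the vertical ones. So its derivative at
`p` is zero, and since the Levi-Civita connections of source and target are metric
(`mvfderiv_inner`), this says `⟨∇F_* (X, Y), F_* Y⟩ = 0` for all `X`. Thus the trilinear form
`⟨∇F_* (X, Y), F_* Z⟩` on horizontal vectors is symmetric in `X, Y` and skew in `Y, Z`, hence zero;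
and the vectors `F_* Z` exhaust the tangent space of `N`.

All computations at `p` take place in the preferred charts at `p`, `F p` and `G (F p)`, in which
the tangent spaces at these points are identified with the model spaces by the identity. No change
of charts is needed.
-/

namespace RiemannianMap

open Bundle Filter Topology

/-! ### Derivatives of vector-valued functions on a manifold -/

section VectorValued

variable {E : Type*} [NormedAddCommGroup E] [NormedSpace ℝ E]
  {M : Type*} [TopologicalSpace M] [ChartedSpace E M]
  {G : Type*} [NormedAddCommGroup G] [NormedSpace ℝ G]
  {G' : Type*} [NormedAddCommGroup G'] [NormedSpace ℝ G']

theorem mvfderiv_congr {f g : M → G} {p : M} (h : f =ᶠ[𝓝 p] g) :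
    mvfderiv 𝓘(ℝ, E) f p = mvfderiv 𝓘(ℝ, E) g p := by
  ext X
  exact DFunLike.congr_fun h.mfderiv_eq X

theorem mvfderiv_finsetSum {ι : Type*} (s : Finset ι) {f : ι → M → G} {p : M}
    (hf : ∀ i ∈ s, MDifferentiableAt 𝓘(ℝ, E) 𝓘(ℝ, G) (f i) p) :
    MDifferentiableAt 𝓘(ℝ, E) 𝓘(ℝ, G) (fun q ↦ ∑ i ∈ s, f i q) p ∧
      mvfderiv 𝓘(ℝ, E) (fun q ↦ ∑ i ∈ s, f i q) p = ∑ i ∈ s, mvfderiv 𝓘(ℝ, E) (f i) p := by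
  classical
  induction s using Finset.induction_on with
  | empty => simpa using ⟨mdifferentiableAt_const, mvfderiv_const (0 : G)⟩
  | insert a s ha ih =>
    obtain ⟨h₁, h₂⟩ := ih fun i hi ↦ hf i (Finset.mem_insert_of_mem hi)
    have h₀ := hf a (Finset.mem_insert_self a s)
    simp only [Finset.sum_insert ha]
    exact ⟨h₀.add h₁, by rw [mvfderiv_fun_add h₀ h₁, h₂]⟩

theorem mvfderiv_clm_comp (L : G →L[ℝ] G') {f : M → G} {p : M}
    (hf : MDifferentiableAt 𝓘(ℝ, E) 𝓘(ℝ, G) f p) :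
    MDifferentiableAt 𝓘(ℝ, E) 𝓘(ℝ, G') (fun q ↦ L (f q)) p ∧
      ∀ X, mvfderiv 𝓘(ℝ, E) (fun q ↦ L (f q)) p X = L (mvfderiv 𝓘(ℝ, E) f p X) := by
  have h := L.hasMFDerivAt.comp p hf.hasMFDerivAt
  refine ⟨h.mdifferentiableAt, fun X ↦ ?_⟩
  exact DFunLike.congr_fun h.mfderiv X

theorem mvfderiv_eq_zero_of_isLocalMin {f : M → ℝ} {p : M} (h : IsLocalMin f p) :
    mvfderiv 𝓘(ℝ, E) f p = 0 := by
  by_cases hf : MDifferentiableAt 𝓘(ℝ, E) 𝓘(ℝ, ℝ) f p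
  · have h₁ := hf.mvfderiv
    rw [modelWithCornersSelf_coe, Set.range_id, fderivWithin_univ] at h₁
    have h₂ : IsLocalMin (writtenInExtChartAt 𝓘(ℝ, E) 𝓘(ℝ, ℝ) p f) (extChartAt 𝓘(ℝ, E) p p) := by
      have h₃ : Tendsto (extChartAt 𝓘(ℝ, E) p).symm (𝓝 (extChartAt 𝓘(ℝ, E) p p)) (𝓝 p) := by
        simpa using (continuousAt_extChartAt_symm (I := 𝓘(ℝ, E)) p).tendsto
      filter_upwards [h₃.eventually h] with x hx
      change f ((extChartAt 𝓘(ℝ, E) p).symm (extChartAt 𝓘(ℝ, E) p p)) ≤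
        f ((extChartAt 𝓘(ℝ, E) p).symm x)
      rwa [extChartAt_to_inv]
    exact h₁.trans h₂.fderiv_eq_zero
  · ext X
    exact DFunLike.congr_fun (mfderiv_zero_of_not_mdifferentiableAt hf) X

end VectorValued

/-! ### Traces of bilinear maps -/

/-- The trace of a bilinear map with respect to an inner product does not depend on the orthonormal
basis. -/
theorem sum_bilin_orthonormalBasis_eq {V W : Type*} [NormedAddCommGroup V] [InnerProductSpace ℝ V]
    [AddCommGroup W] [Module ℝ W] {ι κ : Type*} [Fintype ι] [Fintype κ]
    (B : V →ₗ[ℝ] V →ₗ[ℝ] W) (b : OrthonormalBasis ι ℝ V) (c : OrthonormalBasis κ ℝ V) :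
    ∑ i, B (b i) (b i) = ∑ j, B (c j) (c j) := by
  classical
  have h (i) : B (b i) (b i) =
      ∑ j, ∑ k, (inner ℝ (c j) (b i) * inner ℝ (b i) (c k)) • B (c j) (c k) := by
    conv_lhs => rw [← c.sum_repr' (b i)]
    simp only [map_sum, map_smul, LinearMap.sum_apply, LinearMap.smul_apply, Finset.smul_sum,
      smul_smul]
    rw [Finset.sum_comm]
    refine Finset.sum_congr rfl fun j _ ↦ Finset.sum_congr rfl fun k _ ↦ ?_
    rw [real_inner_comm (c k) (b i), mul_comm]
  simp only [h]
  rw [Finset.sum_comm]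
  refine Finset.sum_congr rfl fun j _ ↦ ?_
  rw [Finset.sum_comm]
  simp only [← Finset.sum_smul, b.sum_inner_mul_inner, c.inner_eq_ite, ite_smul, one_smul,
    zero_smul]
  simp

/-! ### Coordinate fields -/

section CoordField

variable {E : Type*} [NormedAddCommGroup E] [NormedSpace ℝ E]
  {N : Type*} [TopologicalSpace N] [ChartedSpace E N] [IsManifold 𝓘(ℝ, E) ∞ N]

/-- The trivialization of the tangent bundle given by the chart at `y` is the identity on
`T_y N`. -/
theorem trivializationAt_self_apply (y : N) (v : TangentSpace 𝓘(ℝ, E) y) :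
    (trivializationAt E (TangentSpace 𝓘(ℝ, E) : N → Type _) y ⟨y, v⟩).2 = v := by
  have h := (tangentBundleCore 𝓘(ℝ, E) N).coordChange_self (achart E y) y (mem_chart_source E y) v
  exact h

theorem trivializationAt_self_symm (y : N) (v : TangentSpace 𝓘(ℝ, E) y) :
    (trivializationAt E (TangentSpace 𝓘(ℝ, E) : N → Type _) y).symm y v = v := by
  have h := FiberBundle.extend_apply_self E v
  rw [FiberBundle.extend, trivializationAt_self_apply] at h
  exact h

theorem coordField_self {y : N} (v : TangentSpace 𝓘(ℝ, E) y) : coordField v y = v :=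
  FiberBundle.extend_apply_self E v

theorem coordField_eq_symmL {y z : N} (v : TangentSpace 𝓘(ℝ, E) y)
    (hz : z ∈ (trivializationAt E (TangentSpace 𝓘(ℝ, E) : N → Type _) y).baseSet) :
    coordField v z =
      (trivializationAt E (TangentSpace 𝓘(ℝ, E) : N → Type _) y).symmL ℝ z v := by
  rw [coordField, FiberBundle.extend, trivializationAt_self_apply]
  exact (Trivialization.symmL_apply _ hz _).symm

theorem eventually_mem_baseSet (y : N) :
    ∀ᶠ z in 𝓝 y, z ∈ (trivializationAt E (TangentSpace 𝓘(ℝ, E) : N → Type _) y).baseSet :=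
  (trivializationAt E (TangentSpace 𝓘(ℝ, E) : N → Type _) y).open_baseSet.mem_nhds
    (FiberBundle.mem_baseSet_trivializationAt' y)

theorem eventually_coordField_add {y : N} (v w : TangentSpace 𝓘(ℝ, E) y) :
    ∀ᶠ z in 𝓝 y, coordField (v + w) z = coordField v z + coordField w z := by
  filter_upwards [eventually_mem_baseSet (E := E) y] with z hz
  simp only [coordField_eq_symmL _ hz]
  exact map_add _ _ _

theorem eventually_coordField_smul {y : N} (c : ℝ) (v : TangentSpace 𝓘(ℝ, E) y) :
    ∀ᶠ z in 𝓝 y, coordField (c • v) z = c • coordField v z := by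
  filter_upwards [eventually_mem_baseSet (E := E) y] with z hz
  simp only [coordField_eq_symmL _ hz]
  exact map_smul _ _ _

/-- The components of a coordinate field are constant. -/
theorem trivializationAt_coordField {y z : N} (v : TangentSpace 𝓘(ℝ, E) y)
    (hz : z ∈ (trivializationAt E (TangentSpace 𝓘(ℝ, E) : N → Type _) y).baseSet) :
    (trivializationAt E (TangentSpace 𝓘(ℝ, E) : N → Type _) y ⟨z, coordField v z⟩).2 = v := by
  rw [coordField, FiberBundle.extend, trivializationAt_self_apply]
  exact congrArg Prod.snd (Bundle.Trivialization.apply_mk_symm _ hz v)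

theorem mdifferentiableAt_coordField {y : N} (v : TangentSpace 𝓘(ℝ, E) y) :
    MDifferentiableAt 𝓘(ℝ, E) (𝓘(ℝ, E).prod 𝓘(ℝ, E))
      (fun z ↦ TotalSpace.mk' E z (coordField v z)) y := by
  exact FiberBundle.mdifferentiableAt_extend 𝓘(ℝ, E) E v

end CoordField

/-! ### Christoffel symbols -/

section Christoffel

variable {E : Type*} [NormedAddCommGroup E] [NormedSpace ℝ E]
  {N : Type*} [TopologicalSpace N] [ChartedSpace E N] [IsManifold 𝓘(ℝ, E) ∞ N]
  [RiemannianBundle (fun y : N ↦ TangentSpace 𝓘(ℝ, E) y)]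

theorem mvfderiv_inner_coordField_comm (y : N) (u v w : TangentSpace 𝓘(ℝ, E) y) :
    mvfderiv 𝓘(ℝ, E) (fun z : N ↦ inner ℝ (coordField v z) (coordField w z)) y u =
      mvfderiv 𝓘(ℝ, E) (fun z : N ↦ inner ℝ (coordField w z) (coordField v z)) y u := by
  simp only [real_inner_comm (coordField v _) (coordField w _)]

theorem koszul_add_swap (y : N) (u v w : TangentSpace 𝓘(ℝ, E) y) :
    koszul y u v w + koszul y u w v =
      mvfderiv 𝓘(ℝ, E) (fun z : N ↦ inner ℝ (coordField v z) (coordField w z)) y u := by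
  simp only [koszul, mvfderiv_inner_coordField_comm y _ w v]
  ring

theorem koszul_comm (y : N) (u v w : TangentSpace 𝓘(ℝ, E) y) :
    koszul y u v w = koszul y v u w := by
  simp only [koszul, mvfderiv_inner_coordField_comm y _ v u]
  ring

/-- The Levi-Civita connection is torsion-free. -/
theorem christoffel_comm [FiniteDimensional ℝ E] (y : N) (u v : TangentSpace 𝓘(ℝ, E) y) :
    christoffel y u v = christoffel y v u := by
  simp only [christoffel, koszul_comm y u v]

variable [IsContMDiffRiemannianBundle 𝓘(ℝ, E) ∞ E (fun y : N ↦ TangentSpace 𝓘(ℝ, E) y)]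

theorem mdifferentiableAt_inner_coordField {y : N} (v w : TangentSpace 𝓘(ℝ, E) y) :
    MDifferentiableAt 𝓘(ℝ, E) 𝓘(ℝ, ℝ)
      (fun z : N ↦ inner ℝ (coordField v z) (coordField w z)) y := by
  exact MDifferentiableAt.inner_bundle (IB := 𝓘(ℝ, E)) (F := E)
    (mdifferentiableAt_coordField v) (mdifferentiableAt_coordField w)

theorem mvfderiv_inner_coordField_add_left (y : N) (u v v' w : TangentSpace 𝓘(ℝ, E) y) :
    mvfderiv 𝓘(ℝ, E) (fun z : N ↦ inner ℝ (coordField (v + v') z) (coordField w z)) y u =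
      mvfderiv 𝓘(ℝ, E) (fun z : N ↦ inner ℝ (coordField v z) (coordField w z)) y u +
      mvfderiv 𝓘(ℝ, E) (fun z : N ↦ inner ℝ (coordField v' z) (coordField w z)) y u := by
  rw [mvfderiv_congr (g := fun z ↦ inner ℝ (coordField v z) (coordField w z) +
      inner ℝ (coordField v' z) (coordField w z)) ?_,
    mvfderiv_fun_add (mdifferentiableAt_inner_coordField v w)
      (mdifferentiableAt_inner_coordField v' w)]
  · rfl
  · filter_upwards [eventually_coordField_add v v'] with z hz
    rw [hz, inner_add_left]

theorem mvfderiv_inner_coordField_smul_left (y : N) (c : ℝ) (u v w : TangentSpace 𝓘(ℝ, E) y) :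
    mvfderiv 𝓘(ℝ, E) (fun z : N ↦ inner ℝ (coordField (c • v) z) (coordField w z)) y u =
      c * mvfderiv 𝓘(ℝ, E) (fun z : N ↦ inner ℝ (coordField v z) (coordField w z)) y u := by
  rw [mvfderiv_congr (g := fun z ↦ c * inner ℝ (coordField v z) (coordField w z)) ?_,
    mvfderiv_fun_mul mdifferentiableAt_const (mdifferentiableAt_inner_coordField v w),
    mvfderiv_const]
  · simp
  · filter_upwards [eventually_coordField_smul c v] with z hz
    rw [hz, real_inner_smul_left]

theorem koszul_add_left (y : N) (u u' v w : TangentSpace 𝓘(ℝ, E) y) :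
    koszul y (u + u') v w = koszul y u v w + koszul y u' v w := by
  simp only [koszul, mvfderiv_inner_coordField_add_left, map_add]
  ring

theorem koszul_smul_left (y : N) (c : ℝ) (u v w : TangentSpace 𝓘(ℝ, E) y) :
    koszul y (c • u) v w = c * koszul y u v w := by
  simp only [koszul, mvfderiv_inner_coordField_smul_left, map_smul, smul_eq_mul]
  ring

theorem koszul_add_right (y : N) (u v w w' : TangentSpace 𝓘(ℝ, E) y) :
    koszul y u v (w + w') = koszul y u v w + koszul y u v w' := by
  simp only [koszul, mvfderiv_inner_coordField_comm y _ _ (w + w'),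
    mvfderiv_inner_coordField_add_left, map_add]
  simp only [mvfderiv_inner_coordField_comm y _ w, mvfderiv_inner_coordField_comm y _ w']
  ring

theorem koszul_smul_right (y : N) (c : ℝ) (u v w : TangentSpace 𝓘(ℝ, E) y) :
    koszul y u v (c • w) = c * koszul y u v w := by
  simp only [koszul, mvfderiv_inner_coordField_comm y _ _ (c • w),
    mvfderiv_inner_coordField_smul_left, map_smul, smul_eq_mul]
  simp only [mvfderiv_inner_coordField_comm y _ w]
  ring

variable [FiniteDimensional ℝ E]

theorem inner_christoffel (y : N) (u v w : TangentSpace 𝓘(ℝ, E) y) :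
    inner ℝ (christoffel y u v) w = koszul y u v w := by
  let k : TangentSpace 𝓘(ℝ, E) y →ₗ[ℝ] ℝ :=
    { toFun := koszul y u v
      map_add' := koszul_add_right y u v
      map_smul' := fun c w ↦ koszul_smul_right y c u v w }
  change _ = k w
  conv_rhs => rw [← (stdOrthonormalBasis ℝ (TangentSpace 𝓘(ℝ, E) y)).sum_repr' w]
  simp only [christoffel, sum_inner, real_inner_smul_left, map_sum, map_smul, smul_eq_mul]
  exact Finset.sum_congr rfl fun i _ ↦ mul_comm _ _

theorem christoffel_add_left (y : N) (u u' v : TangentSpace 𝓘(ℝ, E) y) :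
    christoffel y (u + u') v = christoffel y u v + christoffel y u' v := by
  simp only [christoffel, koszul_add_left, add_smul, Finset.sum_add_distrib]

theorem christoffel_smul_left (y : N) (c : ℝ) (u v : TangentSpace 𝓘(ℝ, E) y) :
    christoffel y (c • u) v = c • christoffel y u v := by
  simp only [christoffel, koszul_smul_left, mul_smul, Finset.smul_sum]

theorem christoffel_add_right (y : N) (u v v' : TangentSpace 𝓘(ℝ, E) y) :
    christoffel y u (v + v') = christoffel y u v + christoffel y u v' := by
  simp only [christoffel_comm y u, christoffel_add_left]

theorem christoffel_smul_right (y : N) (c : ℝ) (u v : TangentSpace 𝓘(ℝ, E) y) :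
    christoffel y u (c • v) = c • christoffel y u v := by
  simp only [christoffel_comm y u, christoffel_smul_left]

/-- The Levi-Civita connection is metric, for coordinate fields. -/
theorem inner_christoffel_add_inner_christoffel (y : N) (u v w : TangentSpace 𝓘(ℝ, E) y) :
    inner ℝ (christoffel y u v) w + inner ℝ v (christoffel y u w) =
      mvfderiv 𝓘(ℝ, E) (fun z : N ↦ inner ℝ (coordField v z) (coordField w z)) y u := by
  rw [real_inner_comm (christoffel y u w) v, inner_christoffel, inner_christoffel, koszul_add_swap]

end Christoffel

/-! ### Vector fields along a map -/

section Components

variable {E : Type*} [NormedAddCommGroup E] [NormedSpace ℝ E]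
  {M : Type*}
  {E' : Type*} [NormedAddCommGroup E'] [NormedSpace ℝ E']
  {N : Type*} [TopologicalSpace N] [ChartedSpace E' N] [IsManifold 𝓘(ℝ, E') ∞ N]

/-- The components, in the chart of `N` at `F p`, of a vector field `V` along `F`. Where `F q` is
not in the domain of this chart they carry no meaning. -/
noncomputable def components (F : M → N) (V : ∀ q : M, TangentSpace 𝓘(ℝ, E') (F q)) (p : M) :
    M → E' :=
  fun q ↦ (trivializationAt E' (TangentSpace 𝓘(ℝ, E') : N → Type _) (F p) ⟨F q, V q⟩).2

theorem components_self (F : M → N) (V : ∀ q : M, TangentSpace 𝓘(ℝ, E') (F q)) (p : M) :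
    components F V p p = V p :=
  trivializationAt_self_apply _ _

variable [TopologicalSpace M]

/-- Near `p`, a vector field along `F` is the combination of coordinate fields given by its
components. -/
theorem eventually_eq_sum_components {F : M → N} {p : M} (hF : ContinuousAt F p)
    (V : ∀ q : M, TangentSpace 𝓘(ℝ, E') (F q)) {ι : Type*} [Fintype ι] (b : Module.Basis ι ℝ E')
    {c : ι → TangentSpace 𝓘(ℝ, E') (F p)} (hc : ∀ i, c i = b i) :
    ∀ᶠ q in 𝓝 p, V q = ∑ i, b.repr (components F V p q) i • coordField (c i) (F q) := by
  filter_upwards [hF.eventually (eventually_mem_baseSet (E := E') (F p))] with q hq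
  simp only [coordField_eq_symmL _ hq]
  let T := trivializationAt E' (TangentSpace 𝓘(ℝ, E') : N → Type _) (F p)
  have h : T.symmL ℝ (F q) (components F V p q) = V q := by
    have h1 := T.symmL_continuousLinearMapAt (R := ℝ) hq (V q)
    rw [T.continuousLinearMapAt_apply_of_mem ℝ hq] at h1
    exact h1
  conv_lhs => rw [← h, ← b.sum_repr (components F V p q), map_sum]
  refine Finset.sum_congr rfl fun i _ ↦ ?_
  rw [map_smul, ← hc i]

variable [ChartedSpace E M]

/-- The derivative in the direction `X ∈ T_p M` of the components of a vector field `V` along `F`,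
read as a vector of `T_{F p} N`. -/
noncomputable def componentDeriv (F : M → N) (V : ∀ q : M, TangentSpace 𝓘(ℝ, E') (F q)) (p : M)
    (X : TangentSpace 𝓘(ℝ, E) p) : TangentSpace 𝓘(ℝ, E') (F p) :=
  mvfderiv 𝓘(ℝ, E) (components F V p) p X

theorem covDerivAlong_eq [FiniteDimensional ℝ E']
    [RiemannianBundle (fun y : N ↦ TangentSpace 𝓘(ℝ, E') y)]
    (F : M → N) (V : ∀ q : M, TangentSpace 𝓘(ℝ, E') (F q)) (p : M) (X : TangentSpace 𝓘(ℝ, E) p) :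
    covDerivAlong E E' F V p X = componentDeriv F V p X
      + christoffel (F p) (mfderiv 𝓘(ℝ, E) 𝓘(ℝ, E') F p X) (V p) := by
  unfold covDerivAlong
  exact congrArg (· + _) (trivializationAt_self_symm _ _)

end Components

section MetricConnection

variable {E : Type*} [NormedAddCommGroup E] [NormedSpace ℝ E]
  {M : Type*} [TopologicalSpace M] [ChartedSpace E M]
  {E' : Type*} [NormedAddCommGroup E'] [NormedSpace ℝ E'] [FiniteDimensional ℝ E']
  {N : Type*} [TopologicalSpace N] [ChartedSpace E' N] [IsManifold 𝓘(ℝ, E') ∞ N]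
  [RiemannianBundle (fun y : N ↦ TangentSpace 𝓘(ℝ, E') y)]
  [IsContMDiffRiemannianBundle 𝓘(ℝ, E') ∞ E' (fun y : N ↦ TangentSpace 𝓘(ℝ, E') y)]

/-- The pullback along `F` of the Levi-Civita connection is metric: both fields are expanded in
coordinate fields `c i`, for which this is `inner_christoffel_add_inner_christoffel`, and the
product rule does the rest. -/
theorem mvfderiv_inner {F : M → N} {p : M} (hF : MDifferentiableAt 𝓘(ℝ, E) 𝓘(ℝ, E') F p)
    {V W : ∀ q : M, TangentSpace 𝓘(ℝ, E') (F q)}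
    (hV : MDifferentiableAt 𝓘(ℝ, E) 𝓘(ℝ, E') (components F V p) p)
    (hW : MDifferentiableAt 𝓘(ℝ, E) 𝓘(ℝ, E') (components F W p) p) :
    MDifferentiableAt 𝓘(ℝ, E) 𝓘(ℝ, ℝ) (fun q ↦ inner ℝ (V q) (W q)) p ∧
    ∀ X : TangentSpace 𝓘(ℝ, E) p, mvfderiv 𝓘(ℝ, E) (fun q ↦ inner ℝ (V q) (W q)) p X =
      inner ℝ (covDerivAlong E E' F V p X) (W p) + inner ℝ (V p) (covDerivAlong E E' F W p X) := by
  let b := Module.finBasis ℝ E'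
  let c : Fin _ → TangentSpace 𝓘(ℝ, E') (F p) := fun i ↦ b i
  have hc (i) : c i = b i := rfl
  -- `r'` and `r` are the coordinate functionals, on the tangent space and on the model space; the
  -- latter apply to the components at points other than `p`.
  let r' : Fin _ → TangentSpace 𝓘(ℝ, E') (F p) →ₗ[ℝ] ℝ := fun i ↦ b.coord i
  have key (v : TangentSpace 𝓘(ℝ, E') (F p)) : v = ∑ i, r' i v • c i := (b.sum_repr v).symm
  let r : Fin _ → E' →L[ℝ] ℝ := fun i ↦ LinearMap.toContinuousLinearMap (b.coord i)
  let h : Fin _ → Fin _ → N → ℝ := fun i j z ↦ inner ℝ (coordField (c i) z) (coordField (c j) z)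
  have hev : (fun q ↦ inner ℝ (V q) (W q)) =ᶠ[𝓝 p] fun q ↦ ∑ i, ∑ j,
      (r i (components F V p q) * r j (components F W p q)) * (h i j ∘ F) q := by
    filter_upwards [eventually_eq_sum_components hF.continuousAt V b hc,
      eventually_eq_sum_components hF.continuousAt W b hc] with q h₁ h₂
    rw [h₁, h₂, sum_inner]
    refine Finset.sum_congr rfl fun i _ ↦ ?_
    rw [inner_sum]
    refine Finset.sum_congr rfl fun j _ ↦ ?_
    rw [real_inner_smul_left, real_inner_smul_right, ← mul_assoc]
    rfl
  have hh (i j) : MDifferentiableAt 𝓘(ℝ, E) 𝓘(ℝ, ℝ) (h i j ∘ F) p :=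
    (mdifferentiableAt_inner_coordField (c i) (c j)).comp p hF
  have hVi (i) := mvfderiv_clm_comp (r i) hV
  have hWj (j) := mvfderiv_clm_comp (r j) hW
  have hij (i j) : MDifferentiableAt 𝓘(ℝ, E) 𝓘(ℝ, ℝ) (fun q ↦
      (r i (components F V p q) * r j (components F W p q)) * (h i j ∘ F) q) p :=
    ((hVi i).1.mul (hWj j).1).mul (hh i j)
  have hi (i) := mvfderiv_finsetSum Finset.univ fun j _ ↦ hij i j
  have hs := mvfderiv_finsetSum Finset.univ fun i _ ↦ (hi i).1
  refine ⟨hs.1.congr_of_eventuallyEq hev, fun X ↦ ?_⟩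
  let Γ : TangentSpace 𝓘(ℝ, E') (F p) →ₗ[ℝ] TangentSpace 𝓘(ℝ, E') (F p) :=
    { toFun := christoffel (F p) (mfderiv 𝓘(ℝ, E) 𝓘(ℝ, E') F p X)
      map_add' := christoffel_add_right _ _
      map_smul' := fun k v ↦ christoffel_smul_right _ k _ v }
  rw [mvfderiv_congr hev, hs.2]
  simp only [(hi _).2, FunLike.coe_sum, Finset.sum_apply]
  -- The product rule for each summand; the four resulting sums are evaluated by `bil`.
  have hd (i j) : mvfderiv 𝓘(ℝ, E) (fun q ↦
      (r i (components F V p q) * r j (components F W p q)) * (h i j ∘ F) q) p X =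
      r' i (V p) * r' j (W p) * inner ℝ (Γ (c i)) (c j)
      + r' i (V p) * r' j (W p) * inner ℝ (c i) (Γ (c j))
      + r' i (componentDeriv F V p X) * r' j (W p) * inner ℝ (c i) (c j)
      + r' i (V p) * r' j (componentDeriv F W p X) * inner ℝ (c i) (c j) := by
    have hm : MDifferentiableAt 𝓘(ℝ, E) 𝓘(ℝ, ℝ) (fun q ↦
      r i (components F V p q) * r j (components F W p q)) p := (hVi i).1.mul (hWj j).1
    rw [mvfderiv_fun_mul hm (hh i j), mvfderiv_fun_mul (hVi i).1 (hWj j).1]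
    have e₁ : mvfderiv 𝓘(ℝ, E) (h i j ∘ F) p X =
        inner ℝ (Γ (c i)) (c j) + inner ℝ (c i) (Γ (c j)) :=
      (mvfderiv_comp_apply p (mdifferentiableAt_inner_coordField (c i) (c j)) hF X).trans
        (inner_christoffel_add_inner_christoffel (F p) _ (c i) (c j)).symm
    have e₂ : (h i j ∘ F) p = inner ℝ (c i) (c j) := by
      simp only [h, Function.comp_apply, coordField_self]
    have e₃ : _ = r' i (componentDeriv F V p X) := (hVi i).2 X
    have e₅ : r i (components F V p p) = r' i (V p) := congrArg (r i) (components_self F V p)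
    have e₄ : _ = r' j (componentDeriv F W p X) := (hWj j).2 X
    have e₆ : r j (components F W p p) = r' j (W p) := congrArg (r j) (components_self F W p)
    simp only [_root_.add_apply, _root_.smul_apply, smul_eq_mul, e₁, e₂, e₃, e₄, e₅, e₆]
    ring
  have bil (B : TangentSpace 𝓘(ℝ, E') (F p) →ₗ[ℝ] TangentSpace 𝓘(ℝ, E') (F p) →ₗ[ℝ] ℝ)
      (v w : TangentSpace 𝓘(ℝ, E') (F p)) :
      ∑ i, ∑ j, r' i v * r' j w * B (c i) (c j) = B v w := by
    conv_rhs => rw [key v, key w]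
    simp only [map_sum, map_smul, LinearMap.sum_apply, LinearMap.smul_apply, smul_eq_mul,
      Finset.mul_sum]
    rw [Finset.sum_comm]
    exact Finset.sum_congr rfl fun j _ ↦ Finset.sum_congr rfl fun i _ ↦ by ring
  simp only [hd, Finset.sum_add_distrib]
  have b₁ := bil ((innerₗ _).comp Γ) (V p) (W p)
  have b₂ := bil ((innerₗ _).compl₂ Γ) (V p) (W p)
  have b₃ := bil (innerₗ _) (componentDeriv F V p X) (W p)
  have b₄ := bil (innerₗ _) (V p) (componentDeriv F W p X)
  simp only [LinearMap.comp_apply, LinearMap.compl₂_apply, innerₗ_apply_apply] at b₁ b₂ b₃ b₄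
  rw [b₁, b₂, b₃, b₄, covDerivAlong_eq, covDerivAlong_eq, inner_add_left, inner_add_right]
  change _ + _ + _ + _ = _ + inner ℝ (Γ (V p)) _ + (_ + inner ℝ _ (Γ (W p)))
  ring

end MetricConnection

/-! ### Smooth maps in charts -/

section Charts

variable (E : Type*) [NormedAddCommGroup E] [NormedSpace ℝ E]
  {M : Type*} [TopologicalSpace M] [ChartedSpace E M]
  (E' : Type*) [NormedAddCommGroup E'] [NormedSpace ℝ E']
  {N : Type*} [TopologicalSpace N] [ChartedSpace E' N]

/-- The expression of `F` in the charts at `p` and `F p`. -/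
noncomputable def inCharts (F : M → N) (p : M) : E → E' :=
  writtenInExtChartAt 𝓘(ℝ, E) 𝓘(ℝ, E') p F

/-- The second derivative at `p` of the expression of `F` in the charts at `p` and `F p`, taken in
the directions `X, Y ∈ T_p M` and read as a vector of `T_{F p} N`. -/
noncomputable def hess (F : M → N) (p : M) (X Y : TangentSpace 𝓘(ℝ, E) p) :
    TangentSpace 𝓘(ℝ, E') (F p) :=
  fderiv ℝ (fderiv ℝ (inCharts E E' F p)) (extChartAt 𝓘(ℝ, E) p p) X Y

theorem inCharts_self (F : M → N) (p : M) :
    inCharts E E' F p (extChartAt 𝓘(ℝ, E) p p) = extChartAt 𝓘(ℝ, E') (F p) (F p) := by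
  simp [inCharts, writtenInExtChartAt]

variable {E E'} {F : M → N} (hF : ContMDiff 𝓘(ℝ, E) 𝓘(ℝ, E') ∞ F)
include hF

theorem eventually_mem_extChartAt_source (p : M) :
    ∀ᶠ x in 𝓝 (extChartAt 𝓘(ℝ, E) p p),
      F ((extChartAt 𝓘(ℝ, E) p).symm x) ∈ (extChartAt 𝓘(ℝ, E') (F p)).source := by
  have hc : ContinuousAt (F ∘ (extChartAt 𝓘(ℝ, E) p).symm) (extChartAt 𝓘(ℝ, E) p p) :=
    hF.continuous.continuousAt.comp (continuousAt_extChartAt_symm p)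
  exact hc.preimage_mem_nhds (by simpa using extChartAt_source_mem_nhds (I := 𝓘(ℝ, E')) (F p))

theorem contDiffAt_inCharts (p : M) :
    ContDiffAt ℝ ∞ (inCharts E E' F p) (extChartAt 𝓘(ℝ, E) p p) := by
  have h := (contMDiffAt_iff.1 (hF p)).2
  rw [modelWithCornersSelf_coe, Set.range_id, contDiffWithinAt_univ] at h
  exact h

theorem mfderiv_apply_eq_fderiv_inCharts (p : M) (X : TangentSpace 𝓘(ℝ, E) p) :
    mfderiv 𝓘(ℝ, E) 𝓘(ℝ, E') F p X =
      fderiv ℝ (inCharts E E' F p) (extChartAt 𝓘(ℝ, E) p p) X := by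
  have h := (hF.mdifferentiable (by simp) p).mfderiv
  rw [modelWithCornersSelf_coe, Set.range_id, fderivWithin_univ] at h
  exact DFunLike.congr_fun h X

theorem differentiableAt_fderiv_inCharts (p : M) :
    DifferentiableAt ℝ (fderiv ℝ (inCharts E E' F p)) (extChartAt 𝓘(ℝ, E) p p) :=
  ((contDiffAt_inCharts hF p).fderiv_right (m := 1)
    (one_add_one_eq_two.trans_le ENat.LEInfty.out)).differentiableAt (by simp)

theorem hess_comm (p : M) (X Y : TangentSpace 𝓘(ℝ, E) p) : hess E E' F p X Y = hess E E' F p Y X :=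
  ((contDiffAt_inCharts hF p).isSymmSndFDerivAt
    (by simpa using! (ENat.LEInfty.out : (2 : WithTop ℕ∞) ≤ ∞))) X Y

theorem hess_comp {E'' : Type*} [NormedAddCommGroup E''] [NormedSpace ℝ E'']
    {P : Type*} [TopologicalSpace P] [ChartedSpace E'' P] {G : N → P}
    (hG : ContMDiff 𝓘(ℝ, E') 𝓘(ℝ, E'') ∞ G) (p : M) (X Y : TangentSpace 𝓘(ℝ, E) p) :
    hess E E'' (G ∘ F) p X Y =
      hess E' E'' G (F p) (mfderiv 𝓘(ℝ, E) 𝓘(ℝ, E') F p X) (mfderiv 𝓘(ℝ, E) 𝓘(ℝ, E') F p Y)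
      + mfderiv 𝓘(ℝ, E') 𝓘(ℝ, E'') G (F p) (hess E E' F p X Y) := by
  have hx := inCharts_self E E' F p
  have hev : inCharts E E'' (G ∘ F) p =ᶠ[𝓝 (extChartAt 𝓘(ℝ, E) p p)]
      inCharts E' E'' G (F p) ∘ inCharts E E' F p := by
    filter_upwards [eventually_mem_extChartAt_source hF p] with x hx
    simp only [inCharts, writtenInExtChartAt, Function.comp_apply]
    rw [(extChartAt 𝓘(ℝ, E') (F p)).left_inv hx]
  have hf := contDiffAt_inCharts hF p
  have hg : ContDiffAt ℝ ∞ (inCharts E' E'' G (F p))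
      (inCharts E E' F p (extChartAt 𝓘(ℝ, E) p p)) := by
    rw [hx]
    exact contDiffAt_inCharts hG (F p)
  have hd : fderiv ℝ (inCharts E E'' (G ∘ F) p) =ᶠ[𝓝 (extChartAt 𝓘(ℝ, E) p p)] fun x ↦
      (fderiv ℝ (inCharts E' E'' G (F p)) (inCharts E E' F p x)).comp
        (fderiv ℝ (inCharts E E' F p) x) := by
    have hf1 := (hf.of_le (m := 1) ENat.LEInfty.out).eventually (by simp)
    have hg1 := hf.continuousAt.eventually
      ((hg.of_le (m := 1) ENat.LEInfty.out).eventually (by simp))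
    filter_upwards [hev.eventuallyEq_nhds, hf1, hg1] with x h₁ h₂ h₃
    rw [h₁.fderiv_eq]
    exact fderiv_comp x (h₃.differentiableAt (by simp)) (h₂.differentiableAt (by simp))
  have hG' : HasFDerivAt (fderiv ℝ (inCharts E' E'' G (F p)))
      (fderiv ℝ (fderiv ℝ (inCharts E' E'' G (F p))) (extChartAt 𝓘(ℝ, E') (F p) (F p)))
      (inCharts E E' F p (extChartAt 𝓘(ℝ, E) p p)) := by
    rw [hx]
    exact (differentiableAt_fderiv_inCharts hG (F p)).hasFDerivAt
  have hF' := (differentiableAt_fderiv_inCharts hF p).hasFDerivAt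
  have hfd := (hf.differentiableAt (by simp)).hasFDerivAt
  have hD := (hG'.comp _ hfd).clm_comp hF'
  rw [Function.comp_apply, hx] at hD
  rw [mfderiv_apply_eq_fderiv_inCharts hF p X, mfderiv_apply_eq_fderiv_inCharts hF p Y,
    mfderiv_apply_eq_fderiv_inCharts hG (F p)]
  unfold hess
  rw [hd.fderiv_eq]
  refine (congrArg (fun L : E →L[ℝ] E →L[ℝ] E'' ↦ L (show E from X) (show E from Y))
    hD.fderiv).trans ?_
  exact add_comm (G := E'') _ _

variable [IsManifold 𝓘(ℝ, E) ∞ M] [IsManifold 𝓘(ℝ, E') ∞ N]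

/-- In the charts at `p` and `F p`, the components of `F_* Y`, for a coordinate field `Y`, are the
partial derivative of `F` in the direction `Y`. -/
theorem components_pushField_eventuallyEq (p : M) (Y : TangentSpace 𝓘(ℝ, E) p) :
    components F (pushField E E' F (coordField Y)) p =ᶠ[𝓝 p]
      fun q ↦ fderiv ℝ (inCharts E E' F p) (extChartAt 𝓘(ℝ, E) p q) Y := by
  filter_upwards [eventually_mem_baseSet (E := E) p,
    hF.continuous.continuousAt.eventually (eventually_mem_baseSet (E := E') (F p))] with q h₁ h₂
  have h₁' : q ∈ (chartAt E p).source := h₁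
  have h₂' : F q ∈ (chartAt E' (F p)).source := h₂
  have hs := TangentBundle.symmL_trivializationAt (I := 𝓘(ℝ, E)) h₁'
  have ht := TangentBundle.continuousLinearMapAt_trivializationAt (I := 𝓘(ℝ, E')) h₂'
  rw [modelWithCornersSelf_coe, Set.range_id, mfderivWithin_univ] at hs
  have hφ : MDifferentiableAt 𝓘(ℝ, E) 𝓘(ℝ, E) (extChartAt 𝓘(ℝ, E) p).symm
      (extChartAt 𝓘(ℝ, E) p q) := by
    have h := mdifferentiableWithinAt_extChartAt_symm (I := 𝓘(ℝ, E)) (x := p)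
      ((extChartAt 𝓘(ℝ, E) p).map_source (by simpa using h₁'))
    rwa [modelWithCornersSelf_coe, Set.range_id, mdifferentiableWithinAt_univ] at h
  have hq : (extChartAt 𝓘(ℝ, E) p).symm (extChartAt 𝓘(ℝ, E) p q) = q :=
    (extChartAt 𝓘(ℝ, E) p).left_inv (by simpa using h₁')
  have hFq : MDifferentiableAt 𝓘(ℝ, E) 𝓘(ℝ, E') F q := hF.mdifferentiable (by simp) q
  have hψ := mdifferentiableAt_extChartAt (I := 𝓘(ℝ, E')) h₂'
  have e₁ : mfderiv 𝓘(ℝ, E) 𝓘(ℝ, E') (inCharts E E' F p) (extChartAt 𝓘(ℝ, E) p q) Y =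
      mfderiv 𝓘(ℝ, E') 𝓘(ℝ, E') (extChartAt 𝓘(ℝ, E') (F p)) (F q)
        (mfderiv 𝓘(ℝ, E) 𝓘(ℝ, E') F q
          (mfderiv 𝓘(ℝ, E) 𝓘(ℝ, E) (extChartAt 𝓘(ℝ, E) p).symm (extChartAt 𝓘(ℝ, E) p q) Y)) :=
    (mfderiv_comp_apply_of_eq _ (hψ.comp q hFq) hφ hq Y).trans (mfderiv_comp_apply q hψ hFq _)
  rw [mfderiv_eq_fderiv] at e₁
  refine Eq.trans ?_ e₁.symm
  rw [← hs, ← ht]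
  have e₂ := coordField_eq_symmL Y h₁
  let T := trivializationAt E' (TangentSpace 𝓘(ℝ, E') : N → Type _) (F p)
  refine (T.continuousLinearMapAt_apply_of_mem ℝ h₂
    (mfderiv 𝓘(ℝ, E) 𝓘(ℝ, E') F q (coordField Y q))).symm.trans ?_
  exact congrArg (fun v ↦ T.continuousLinearMapAt ℝ (F q) (mfderiv 𝓘(ℝ, E) 𝓘(ℝ, E') F q v)) e₂

theorem mdifferentiableAt_components_pushField (p : M) (Y : TangentSpace 𝓘(ℝ, E) p) :
    MDifferentiableAt 𝓘(ℝ, E) 𝓘(ℝ, E') (components F (pushField E E' F (coordField Y)) p) p := by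
  refine MDifferentiableAt.congr_of_eventuallyEq ?_ (components_pushField_eventuallyEq hF p Y)
  have h : DifferentiableAt ℝ (fun x ↦ fderiv ℝ (inCharts E E' F p) x Y)
      (extChartAt 𝓘(ℝ, E) p p) :=
    (differentiableAt_fderiv_inCharts hF p).clm_apply (differentiableAt_const _)
  exact h.mdifferentiableAt.comp p (mdifferentiableAt_extChartAt (mem_chart_source E p))

theorem componentDeriv_pushField (p : M) (X Y : TangentSpace 𝓘(ℝ, E) p) :
    componentDeriv F (pushField E E' F (coordField Y)) p X = hess E E' F p X Y := by
  have h : HasFDerivAt (fun x ↦ fderiv ℝ (inCharts E E' F p) x Y)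
      ((fderiv ℝ (fderiv ℝ (inCharts E E' F p)) (extChartAt 𝓘(ℝ, E) p p)).flip (show E from Y))
      (extChartAt 𝓘(ℝ, E) p p) :=
    (ContinuousLinearMap.apply ℝ E' (show E from Y)).hasFDerivAt.comp _
      (differentiableAt_fderiv_inCharts hF p).hasFDerivAt
  have h₁ := mdifferentiableAt_extChartAt (I := 𝓘(ℝ, E)) (mem_chart_source E p)
  have h₂ := mfderiv_comp_apply p h.differentiableAt.mdifferentiableAt h₁ X
  rw [mfderiv_extChartAt_self, mfderiv_eq_fderiv, h.fderiv] at h₂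
  refine Eq.trans ?_ h₂
  exact DFunLike.congr_fun (mvfderiv_congr (components_pushField_eventuallyEq hF p Y)) X

end Charts

/-! ### Functions that become differentiable after a submersion -/

section Submersion

/-- A function is differentiable at `f x` if its composition with a submersion `f` is differentiable
at `x`: it is recovered from the composition by means of a local section of `f`. -/
theorem differentiableAt_of_comp_of_surjective {E E' G : Type*}
    [NormedAddCommGroup E] [NormedSpace ℝ E]
    [NormedAddCommGroup E'] [NormedSpace ℝ E'] [FiniteDimensional ℝ E']
    [NormedAddCommGroup G] [NormedSpace ℝ G]
    {f : E → E'} {A : E →L[ℝ] E'} {x : E} (hf : HasStrictFDerivAt f A x)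
    (hA : Function.Surjective A) {k : E' → G} (hk : DifferentiableAt ℝ (k ∘ f) x) :
    DifferentiableAt ℝ k (f x) := by
  -- For a linear right inverse `L` of `A`, the map `v ↦ f (x + L v)` has derivative `1` at `0`, and
  -- its local inverse composed with `v ↦ x + L v` is a section of `f` near `f x`.
  obtain ⟨L₀, hL₀⟩ := A.toLinearMap.exists_rightInverse_of_surjective (LinearMap.range_eq_top.2 hA)
  let L : E' →L[ℝ] E := LinearMap.toContinuousLinearMap L₀
  have hL : A.comp L = ContinuousLinearMap.id ℝ E' := by
    ext v
    exact LinearMap.congr_fun hL₀ v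
  have : CompleteSpace E' := FiniteDimensional.complete ℝ E'
  have hs : HasStrictFDerivAt (fun v ↦ x + L v) L 0 := L.hasStrictFDerivAt.const_add x
  have hfs : HasStrictFDerivAt (fun v ↦ f (x + L v))
      (ContinuousLinearEquiv.refl ℝ E' : E' →L[ℝ] E') 0 := by
    have hf' : HasStrictFDerivAt f A (x + L 0) := by simpa using hf
    have h := hf'.comp 0 hs
    rw [hL] at h
    exact h
  have h0 : f (x + L 0) = f x := by simp
  have hg := hfs.to_localInverse
  have hr := hfs.eventually_right_inverse
  have hi := hfs.localInverse_apply_image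
  rw [h0] at hg hr hi
  have hk' : DifferentiableAt ℝ (k ∘ f) (x + L (hfs.localInverse _ _ _ (f x))) := by
    rw [hi]; simpa using hk
  have hd : DifferentiableAt ℝ (fun y ↦ x + L (hfs.localInverse _ _ _ y)) (f x) :=
    (L.differentiableAt.comp _ hg.differentiableAt).const_add x
  refine (hk'.comp (f x) hd).congr_of_eventuallyEq ?_
  filter_upwards [hr] with y hy
  exact congrArg k hy.symm

variable {E : Type*} [NormedAddCommGroup E] [NormedSpace ℝ E]
  {M : Type*} [TopologicalSpace M] [ChartedSpace E M]
  {E' : Type*} [NormedAddCommGroup E'] [NormedSpace ℝ E'] [FiniteDimensional ℝ E']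
  {N : Type*} [TopologicalSpace N] [ChartedSpace E' N] [IsManifold 𝓘(ℝ, E') ∞ N]
  {G : Type*} [NormedAddCommGroup G] [NormedSpace ℝ G]

theorem mdifferentiableAt_of_comp_of_surjective {F : M → N}
    (hF : ContMDiff 𝓘(ℝ, E) 𝓘(ℝ, E') ∞ F) {p : M}
    (hs : Function.Surjective (mfderiv 𝓘(ℝ, E) 𝓘(ℝ, E') F p)) {k : N → G}
    (hk : MDifferentiableAt 𝓘(ℝ, E) 𝓘(ℝ, G) (k ∘ F) p) :
    MDifferentiableAt 𝓘(ℝ, E') 𝓘(ℝ, G) k (F p) := by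
  have hsf := (contDiffAt_inCharts hF p).hasStrictFDerivAt (by simp)
  have hA : Function.Surjective (fderiv ℝ (inCharts E E' F p) (extChartAt 𝓘(ℝ, E) p p)) := by
    intro v
    obtain ⟨X, hX⟩ := hs v
    exact ⟨X, (mfderiv_apply_eq_fderiv_inCharts hF p X).symm.trans hX⟩
  have h₁ : DifferentiableAt ℝ ((k ∘ (extChartAt 𝓘(ℝ, E') (F p)).symm) ∘ inCharts E E' F p)
      (extChartAt 𝓘(ℝ, E) p p) := by
    have h := hk.differentiableWithinAt_writtenInExtChartAt
    rw [modelWithCornersSelf_coe, Set.range_id, differentiableWithinAt_univ] at h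
    refine h.congr_of_eventuallyEq ?_
    filter_upwards [eventually_mem_extChartAt_source hF p] with x hx
    simp only [inCharts, writtenInExtChartAt, Function.comp_apply]
    rw [(extChartAt 𝓘(ℝ, E') (F p)).left_inv hx]
    rfl
  have h₂ := differentiableAt_of_comp_of_surjective hsf hA h₁
  rw [inCharts_self] at h₂
  have h₃ := h₂.mdifferentiableAt.comp (F p)
    (mdifferentiableAt_extChartAt (I := 𝓘(ℝ, E')) (mem_chart_source E' (F p)))
  refine h₃.congr_of_eventuallyEq ?_
  filter_upwards [extChartAt_source_mem_nhds (I := 𝓘(ℝ, E')) (F p)] with z hz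
  exact congrArg k ((extChartAt 𝓘(ℝ, E') (F p)).left_inv hz).symm

/-- The chain rule for a function `k` precomposed with a submersion `F`. Differentiability of `k`
need not be assumed, because `k ∘ F` is differentiable at `p` only if `k` is at `F p`. -/
theorem mvfderiv_comp_of_surjective {F : M → N}
    (hF : ContMDiff 𝓘(ℝ, E) 𝓘(ℝ, E') ∞ F) {p : M}
    (hs : Function.Surjective (mfderiv 𝓘(ℝ, E) 𝓘(ℝ, E') F p)) (k : N → G)
    (X : TangentSpace 𝓘(ℝ, E) p) :
    mvfderiv 𝓘(ℝ, E) (k ∘ F) p X =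
      mvfderiv 𝓘(ℝ, E') k (F p) (mfderiv 𝓘(ℝ, E) 𝓘(ℝ, E') F p X) := by
  by_cases hk : MDifferentiableAt 𝓘(ℝ, E') 𝓘(ℝ, G) k (F p)
  · exact mfderiv_comp_apply p hk (hF.mdifferentiable (by simp) p) X
  · -- Neither `k` nor `k ∘ F` is differentiable, and both derivatives are zero by convention.
    have hk' : ¬ MDifferentiableAt 𝓘(ℝ, E) 𝓘(ℝ, G) (k ∘ F) p :=
      fun h ↦ hk (mdifferentiableAt_of_comp_of_surjective hF hs h)
    exact (DFunLike.congr_fun (mfderiv_zero_of_not_mdifferentiableAt hk') X).trans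
      (DFunLike.congr_fun (mfderiv_zero_of_not_mdifferentiableAt hk) _).symm

end Submersion

/-! ### The second fundamental form -/

section SecondFundamentalForm

variable {E : Type*} [NormedAddCommGroup E] [NormedSpace ℝ E]
  {M : Type*} [TopologicalSpace M] [ChartedSpace E M] [IsManifold 𝓘(ℝ, E) ∞ M]
  {E' : Type*} [NormedAddCommGroup E'] [NormedSpace ℝ E']
  {N : Type*} [TopologicalSpace N] [ChartedSpace E' N]
  {E'' : Type*} [NormedAddCommGroup E''] [NormedSpace ℝ E'']
  {P : Type*} [TopologicalSpace P] [ChartedSpace E'' P]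
  {F : M → N} {G : N → P}

theorem components_id_coordField_eventuallyEq (p : M) (Y : TangentSpace 𝓘(ℝ, E) p) :
    components (id : M → M) (coordField Y) p =ᶠ[𝓝 p] fun _ ↦ (show E from Y) := by
  filter_upwards [eventually_mem_baseSet (E := E) p] with q hq
  exact trivializationAt_coordField Y hq

theorem pushField_coordField_self (F : M → N) (p : M) (Y : TangentSpace 𝓘(ℝ, E) p) :
    pushField E E' F (coordField Y) p = mfderiv 𝓘(ℝ, E) 𝓘(ℝ, E') F p Y := by
  rw [pushField, coordField_self]

omit [IsManifold 𝓘(ℝ, E) ∞ M] in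
theorem mfderiv_comp_apply_of_contMDiff (hF : ContMDiff 𝓘(ℝ, E) 𝓘(ℝ, E') ∞ F)
    (hG : ContMDiff 𝓘(ℝ, E') 𝓘(ℝ, E'') ∞ G) (p : M) (X : TangentSpace 𝓘(ℝ, E) p) :
    mfderiv 𝓘(ℝ, E) 𝓘(ℝ, E'') (G ∘ F) p X =
      mfderiv 𝓘(ℝ, E') 𝓘(ℝ, E'') G (F p) (mfderiv 𝓘(ℝ, E) 𝓘(ℝ, E') F p X) :=
  mfderiv_comp_apply p (hG.mdifferentiable (by simp) _) (hF.mdifferentiable (by simp) _) X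

variable [FiniteDimensional ℝ E] [FiniteDimensional ℝ E'] [FiniteDimensional ℝ E'']
  [IsManifold 𝓘(ℝ, E') ∞ N] [IsManifold 𝓘(ℝ, E'') ∞ P]
  [RiemannianBundle (fun x : M ↦ TangentSpace 𝓘(ℝ, E) x)]
  [RiemannianBundle (fun y : N ↦ TangentSpace 𝓘(ℝ, E') y)]
  [RiemannianBundle (fun z : P ↦ TangentSpace 𝓘(ℝ, E'') z)]

theorem leviCivita_coordField (p : M) (X Y : TangentSpace 𝓘(ℝ, E) p) :
    leviCivita E (coordField Y) p X = christoffel p X Y := by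
  have h₁ : componentDeriv (id : M → M) (coordField Y) p X = 0 := by
    have h := mvfderiv_congr (E := E) (components_id_coordField_eventuallyEq p Y)
    rw [mvfderiv_const] at h
    exact DFunLike.congr_fun h X
  have h₂ : mfderiv 𝓘(ℝ, E) 𝓘(ℝ, E) (id : M → M) p X = X := by rw [mfderiv_id]; rfl
  have h₃ : coordField Y p = Y := coordField_self Y
  rw [leviCivita, covDerivAlong_eq, h₁, h₂, zero_add, h₃]
  rfl

/-- The second fundamental form in charts:
`∂²F^γ/∂x^i∂x^j + Γ^γ_{αβ} ∂F^α/∂x^i ∂F^β/∂x^j - Γ^k_{ij} ∂F^γ/∂x^k`. -/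
theorem secondFundamentalForm_eq (hF : ContMDiff 𝓘(ℝ, E) 𝓘(ℝ, E') ∞ F) (p : M)
    (X Y : TangentSpace 𝓘(ℝ, E) p) :
    secondFundamentalForm E E' F p X Y = hess E E' F p X Y
      + christoffel (F p) (mfderiv 𝓘(ℝ, E) 𝓘(ℝ, E') F p X) (mfderiv 𝓘(ℝ, E) 𝓘(ℝ, E') F p Y)
      - mfderiv 𝓘(ℝ, E) 𝓘(ℝ, E') F p (christoffel p X Y) := by
  rw [secondFundamentalForm, covDerivAlong_eq, componentDeriv_pushField hF, leviCivita_coordField,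
    pushField_coordField_self]

theorem secondFundamentalForm_comm (hF : ContMDiff 𝓘(ℝ, E) 𝓘(ℝ, E') ∞ F) (p : M)
    (X Y : TangentSpace 𝓘(ℝ, E) p) :
    secondFundamentalForm E E' F p X Y = secondFundamentalForm E E' F p Y X := by
  rw [secondFundamentalForm_eq hF, secondFundamentalForm_eq hF, hess_comm hF,
    christoffel_comm (F p), christoffel_comm p]

theorem secondFundamentalForm_comp (hF : ContMDiff 𝓘(ℝ, E) 𝓘(ℝ, E') ∞ F)
    (hG : ContMDiff 𝓘(ℝ, E') 𝓘(ℝ, E'') ∞ G) (p : M) (X Y : TangentSpace 𝓘(ℝ, E) p) :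
    secondFundamentalForm E E'' (G ∘ F) p X Y =
      secondFundamentalForm E' E'' G (F p) (mfderiv 𝓘(ℝ, E) 𝓘(ℝ, E') F p X)
        (mfderiv 𝓘(ℝ, E) 𝓘(ℝ, E') F p Y)
      + mfderiv 𝓘(ℝ, E') 𝓘(ℝ, E'') G (F p) (secondFundamentalForm E E' F p X Y) := by
  rw [secondFundamentalForm_eq (hG.comp hF), secondFundamentalForm_eq hF,
    secondFundamentalForm_eq hG, hess_comp hF hG, mfderiv_comp_apply_of_contMDiff hF hG,
    mfderiv_comp_apply_of_contMDiff hF hG, mfderiv_comp_apply_of_contMDiff hF hG, map_sub, map_add]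
  simp only [Function.comp_apply]
  abel

omit [FiniteDimensional ℝ E] [IsManifold 𝓘(ℝ, E) ∞ M]
  [RiemannianBundle (fun x : M ↦ TangentSpace 𝓘(ℝ, E) x)]
  [RiemannianBundle (fun y : N ↦ TangentSpace 𝓘(ℝ, E') y)] in
/-- The chain rule for the pullback connection: a vector field along a submersion `F` that comes
from the field `V` on the target has the covariant derivatives of `V`. -/
theorem covDerivAlong_comp (hF : ContMDiff 𝓘(ℝ, E) 𝓘(ℝ, E') ∞ F)
    (hG : ContMDiff 𝓘(ℝ, E') 𝓘(ℝ, E'') ∞ G) {p : M}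
    (hs : Function.Surjective (mfderiv 𝓘(ℝ, E) 𝓘(ℝ, E') F p))
    (V : ∀ y : N, TangentSpace 𝓘(ℝ, E'') (G y)) (X : TangentSpace 𝓘(ℝ, E) p) :
    covDerivAlong E E'' (G ∘ F) (fun q ↦ V (F q)) p X =
      covDerivAlong E' E'' G V (F p) (mfderiv 𝓘(ℝ, E) 𝓘(ℝ, E') F p X) := by
  have h : componentDeriv (G ∘ F) (fun q ↦ V (F q)) p X =
      componentDeriv G V (F p) (mfderiv 𝓘(ℝ, E) 𝓘(ℝ, E') F p X) :=
    mvfderiv_comp_of_surjective hF hs (components G V (F p)) X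
  rw [covDerivAlong_eq, covDerivAlong_eq, h, mfderiv_comp_apply_of_contMDiff hF hG]
  rfl

variable [IsContMDiffRiemannianBundle 𝓘(ℝ, E) ∞ E (fun x : M ↦ TangentSpace 𝓘(ℝ, E) x)]
  [IsContMDiffRiemannianBundle 𝓘(ℝ, E') ∞ E' (fun y : N ↦ TangentSpace 𝓘(ℝ, E') y)]

theorem secondFundamentalForm_add_right (hF : ContMDiff 𝓘(ℝ, E) 𝓘(ℝ, E') ∞ F) (p : M)
    (X Y Z : TangentSpace 𝓘(ℝ, E) p) :
    secondFundamentalForm E E' F p X (Y + Z) =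
      secondFundamentalForm E E' F p X Y + secondFundamentalForm E E' F p X Z := by
  have h : hess E E' F p X (Y + Z) = hess E E' F p X Y + hess E E' F p X Z :=
    map_add (fderiv ℝ (fderiv ℝ (inCharts E E' F p)) (extChartAt 𝓘(ℝ, E) p p) (show E from X))
      (show E from Y) (show E from Z)
  simp only [secondFundamentalForm_eq hF, h, map_add, christoffel_add_right]
  abel

theorem secondFundamentalForm_smul_right (hF : ContMDiff 𝓘(ℝ, E) 𝓘(ℝ, E') ∞ F) (p : M) (c : ℝ)
    (X Y : TangentSpace 𝓘(ℝ, E) p) :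
    secondFundamentalForm E E' F p X (c • Y) = c • secondFundamentalForm E E' F p X Y := by
  have h : hess E E' F p X (c • Y) = c • hess E E' F p X Y :=
    map_smul (fderiv ℝ (fderiv ℝ (inCharts E E' F p)) (extChartAt 𝓘(ℝ, E) p p) (show E from X))
      c (show E from Y)
  simp only [secondFundamentalForm_eq hF, h, map_smul, christoffel_smul_right, smul_add, smul_sub]

/-- The second fundamental form at `p` as a bilinear map. -/
noncomputable def secondFundamentalFormₗ (hF : ContMDiff 𝓘(ℝ, E) 𝓘(ℝ, E') ∞ F) (p : M) :
    TangentSpace 𝓘(ℝ, E) p →ₗ[ℝ] TangentSpace 𝓘(ℝ, E) p →ₗ[ℝ] TangentSpace 𝓘(ℝ, E') (F p) :=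
  LinearMap.mk₂ ℝ (secondFundamentalForm E E' F p)
    (fun X Y Z ↦ by
      simp only [secondFundamentalForm_comm hF p _ Z, secondFundamentalForm_add_right hF])
    (fun c X Y ↦ by
      simp only [secondFundamentalForm_comm hF p _ Y, secondFundamentalForm_smul_right hF])
    (secondFundamentalForm_add_right hF p)
    (fun c X Y ↦ secondFundamentalForm_smul_right hF p c X Y)

end SecondFundamentalForm

/-! ### Horizontal vectors -/

section Horizontal

variable {E : Type*} [NormedAddCommGroup E] [NormedSpace ℝ E]
  {M : Type*} [TopologicalSpace M] [ChartedSpace E M]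
  [RiemannianBundle (fun x : M ↦ TangentSpace 𝓘(ℝ, E) x)]
  {E' : Type*} [NormedAddCommGroup E'] [NormedSpace ℝ E']
  {N : Type*} [TopologicalSpace N] [ChartedSpace E' N]
  {F : M → N}

theorem horizontalSpace_eq_top {p : M} (hi : Function.Injective (mfderiv 𝓘(ℝ, E) 𝓘(ℝ, E') F p)) :
    horizontalSpace E E' F p = ⊤ := by
  have h : (mfderiv 𝓘(ℝ, E) 𝓘(ℝ, E') F p).ker = ⊥ := LinearMap.ker_eq_bot.2 hi
  rw [horizontalSpace, h, Submodule.bot_orthogonal_eq_top]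

theorem inner_eq_zero_of_mfderiv_eq_zero {p : M} {k x : TangentSpace 𝓘(ℝ, E) p}
    (hk : mfderiv 𝓘(ℝ, E) 𝓘(ℝ, E') F p k = 0) (hx : x ∈ horizontalSpace E E' F p) :
    inner ℝ k x = 0 :=
  hx k hk

variable (F) in
theorem exists_vertical_add_horizontal [FiniteDimensional ℝ E] (p : M)
    (v : TangentSpace 𝓘(ℝ, E) p) :
    ∃ k, mfderiv 𝓘(ℝ, E) 𝓘(ℝ, E') F p k = 0 ∧ ∃ x ∈ horizontalSpace E E' F p, v = k + x :=
  (mfderiv 𝓘(ℝ, E) 𝓘(ℝ, E') F p).ker.exists_add_mem_mem_orthogonal v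

theorem exists_mem_horizontalSpace [FiniteDimensional ℝ E] {p : M}
    (hs : Function.Surjective (mfderiv 𝓘(ℝ, E) 𝓘(ℝ, E') F p))
    (v : TangentSpace 𝓘(ℝ, E') (F p)) :
    ∃ x ∈ horizontalSpace E E' F p, mfderiv 𝓘(ℝ, E) 𝓘(ℝ, E') F p x = v := by
  obtain ⟨w, rfl⟩ := hs v
  obtain ⟨k, hk, x, hx, rfl⟩ := exists_vertical_add_horizontal (E' := E') F p w
  exact ⟨x, hx, by rw [map_add, hk, zero_add]⟩

section Composition

variable {E'' : Type*} [NormedAddCommGroup E''] [NormedSpace ℝ E'']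
  {P : Type*} [TopologicalSpace P] [ChartedSpace E'' P] {G : N → P}
  (hF : ContMDiff 𝓘(ℝ, E) 𝓘(ℝ, E') ∞ F) (hG : ContMDiff 𝓘(ℝ, E') 𝓘(ℝ, E'') ∞ G)
include hF hG

omit [RiemannianBundle (fun x : M ↦ TangentSpace 𝓘(ℝ, E) x)] in
theorem rangeSpace_comp {p : M} (hs : Function.Surjective (mfderiv 𝓘(ℝ, E) 𝓘(ℝ, E') F p)) :
    rangeSpace E E'' (G ∘ F) p = rangeSpace E' E'' G (F p) := by
  ext v
  constructor
  · rintro ⟨X, rfl⟩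
    exact ⟨mfderiv 𝓘(ℝ, E) 𝓘(ℝ, E') F p X, (mfderiv_comp_apply_of_contMDiff hF hG p X).symm⟩
  · rintro ⟨Y, rfl⟩
    obtain ⟨X, rfl⟩ := hs Y
    exact ⟨X, mfderiv_comp_apply_of_contMDiff hF hG p X⟩

theorem horizontalSpace_comp {p : M}
    (hi : Function.Injective (mfderiv 𝓘(ℝ, E') 𝓘(ℝ, E'') G (F p))) :
    horizontalSpace E E'' (G ∘ F) p = horizontalSpace E E' F p := by
  unfold horizontalSpace
  congr 1
  ext v
  have h := mfderiv_comp_apply_of_contMDiff hF hG p v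
  constructor
  · exact fun hv ↦ hi ((h.symm.trans hv).trans (map_zero _).symm)
  · exact fun hv ↦ h.trans ((congrArg _ hv).trans (map_zero _))

end Composition

variable [RiemannianBundle (fun y : N ↦ TangentSpace 𝓘(ℝ, E') y)]

/-- A linear map that is isometric on the complement of its kernel does not increase norms. -/
theorem inner_mfderiv_self_le [FiniteDimensional ℝ E] {q : M}
    (h : ∀ X ∈ horizontalSpace E E' F q, ∀ Y ∈ horizontalSpace E E' F q,
      inner ℝ (mfderiv 𝓘(ℝ, E) 𝓘(ℝ, E') F q X) (mfderiv 𝓘(ℝ, E) 𝓘(ℝ, E') F q Y) = inner ℝ X Y)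
    (v : TangentSpace 𝓘(ℝ, E) q) :
    inner ℝ (mfderiv 𝓘(ℝ, E) 𝓘(ℝ, E') F q v) (mfderiv 𝓘(ℝ, E) 𝓘(ℝ, E') F q v) ≤ inner ℝ v v := by
  obtain ⟨k, hk, x, hx, rfl⟩ := exists_vertical_add_horizontal (E' := E') F q v
  have hkx := inner_eq_zero_of_mfderiv_eq_zero hk hx
  rw [map_add, hk, zero_add, h x hx x hx, inner_add_add_self, hkx, real_inner_comm k x, hkx]
  linarith [real_inner_self_nonneg (x := k)]

/-- The differential of a Riemannian submersion as an isometry of `(ker F_*)ᗮ` onto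
`T_{F p} N`. -/
noncomputable def IsRiemannianSubmersion.horizontalEquiv [FiniteDimensional ℝ E]
    (hF : IsRiemannianSubmersion E E' F) (p : M) :
    horizontalSpace E E' F p ≃ₗᵢ[ℝ] TangentSpace 𝓘(ℝ, E') (F p) :=
  LinearIsometryEquiv.ofSurjective
    (((mfderiv 𝓘(ℝ, E) 𝓘(ℝ, E') F p).toLinearMap ∘ₗ
        (horizontalSpace E E' F p).subtype).isometryOfInner
      fun X Y ↦ hF.isometry p X X.2 Y Y.2)
    fun v ↦ by
      obtain ⟨x, hx, hv⟩ := exists_mem_horizontalSpace (hF.surjective p) v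
      exact ⟨⟨x, hx⟩, hv⟩

end Horizontal

/-! ### The second fundamental form on horizontal vectors -/

section HorizontalSecondFundamentalForm

variable {E : Type*} [NormedAddCommGroup E] [NormedSpace ℝ E] [FiniteDimensional ℝ E]
  {M : Type*} [TopologicalSpace M] [ChartedSpace E M] [IsManifold 𝓘(ℝ, E) ∞ M]
  [RiemannianBundle (fun x : M ↦ TangentSpace 𝓘(ℝ, E) x)]
  [IsContMDiffRiemannianBundle 𝓘(ℝ, E) ∞ E (fun x : M ↦ TangentSpace 𝓘(ℝ, E) x)]
  {E' : Type*} [NormedAddCommGroup E'] [NormedSpace ℝ E'] [FiniteDimensional ℝ E']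
  {N : Type*} [TopologicalSpace N] [ChartedSpace E' N] [IsManifold 𝓘(ℝ, E') ∞ N]
  [RiemannianBundle (fun y : N ↦ TangentSpace 𝓘(ℝ, E') y)]
  [IsContMDiffRiemannianBundle 𝓘(ℝ, E') ∞ E' (fun y : N ↦ TangentSpace 𝓘(ℝ, E') y)]
  {F : M → N}

/-- The first-order condition at the minimum `p` of `|Y|² - |F_* Y|²`, for `Y` a coordinate field
that is horizontal at `p`. -/
theorem inner_secondFundamentalForm_self (hF : ContMDiff 𝓘(ℝ, E) 𝓘(ℝ, E') ∞ F)
    (h : ∀ p : M, ∀ X ∈ horizontalSpace E E' F p, ∀ Y ∈ horizontalSpace E E' F p,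
      inner ℝ (mfderiv 𝓘(ℝ, E) 𝓘(ℝ, E') F p X) (mfderiv 𝓘(ℝ, E) 𝓘(ℝ, E') F p Y) = inner ℝ X Y)
    (p : M) (X : TangentSpace 𝓘(ℝ, E) p) {Y : TangentSpace 𝓘(ℝ, E) p}
    (hY : Y ∈ horizontalSpace E E' F p) :
    inner ℝ (secondFundamentalForm E E' F p X Y) (mfderiv 𝓘(ℝ, E) 𝓘(ℝ, E') F p Y) = 0 := by
  have d₁ := mdifferentiableAt_inner_coordField Y Y
  have e₁ := inner_christoffel_add_inner_christoffel p X Y Y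
  have hm := mdifferentiableAt_components_pushField hF p Y
  obtain ⟨d₂, e₂⟩ := mvfderiv_inner (hF.mdifferentiable (by simp) p) hm hm
  have hmin : IsLocalMin (fun q ↦ inner ℝ (coordField Y q) (coordField Y q) -
      inner ℝ (pushField E E' F (coordField Y) q) (pushField E E' F (coordField Y) q)) p := by
    refine Eventually.of_forall fun q ↦ ?_
    dsimp only
    rw [pushField_coordField_self, coordField_self, h p Y hY Y hY, sub_self, sub_nonneg]
    exact inner_mfderiv_self_le (h q) _
  have h₀ := DFunLike.congr_fun (mvfderiv_eq_zero_of_isLocalMin (E := E) hmin) X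
  rw [mvfderiv_fun_sub d₁ d₂] at h₀
  have h₁ := (congrArg₂ (· - ·) e₁ (e₂ X).symm).trans h₀
  rw [pushField_coordField_self, real_inner_comm _ (mfderiv 𝓘(ℝ, E) 𝓘(ℝ, E') F p Y),
    real_inner_comm _ Y] at h₁
  have h₂ : inner ℝ (mfderiv 𝓘(ℝ, E) 𝓘(ℝ, E') F p (christoffel p X Y))
      (mfderiv 𝓘(ℝ, E) 𝓘(ℝ, E') F p Y) = inner ℝ (christoffel p X Y) Y := by
    obtain ⟨k, hk, x, hx, hkx⟩ :=
      exists_vertical_add_horizontal (E' := E') F p (christoffel p X Y)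
    rw [hkx, map_add, hk, zero_add, h p x hx Y hY, inner_add_left,
      inner_eq_zero_of_mfderiv_eq_zero hk hY, zero_add]
  have h₃ : inner ℝ (christoffel p X Y) Y + inner ℝ (christoffel p X Y) Y -
      (inner ℝ (covDerivAlong E E' F (pushField E E' F (coordField Y)) p X)
          (mfderiv 𝓘(ℝ, E) 𝓘(ℝ, E') F p Y) +
        inner ℝ (covDerivAlong E E' F (pushField E E' F (coordField Y)) p X)
          (mfderiv 𝓘(ℝ, E) 𝓘(ℝ, E') F p Y)) = 0 := h₁
  rw [secondFundamentalForm, leviCivita_coordField, inner_sub_left, h₂]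
  linarith

/-- The trilinear form `⟨∇F_* (X, Y), F_* Z⟩` on horizontal vectors is symmetric in `X, Y`, and skew
in `Y, Z` by polarization of `inner_secondFundamentalForm_self`, so it is zero. -/
theorem inner_secondFundamentalForm_mfderiv (hF : ContMDiff 𝓘(ℝ, E) 𝓘(ℝ, E') ∞ F)
    (h : ∀ p : M, ∀ X ∈ horizontalSpace E E' F p, ∀ Y ∈ horizontalSpace E E' F p,
      inner ℝ (mfderiv 𝓘(ℝ, E) 𝓘(ℝ, E') F p X) (mfderiv 𝓘(ℝ, E) 𝓘(ℝ, E') F p Y) = inner ℝ X Y)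
    (p : M) {X Y Z : TangentSpace 𝓘(ℝ, E) p} (hX : X ∈ horizontalSpace E E' F p)
    (hY : Y ∈ horizontalSpace E E' F p) (hZ : Z ∈ horizontalSpace E E' F p) :
    inner ℝ (secondFundamentalForm E E' F p X Y) (mfderiv 𝓘(ℝ, E) 𝓘(ℝ, E') F p Z) = 0 := by
  have skew {U V W : TangentSpace 𝓘(ℝ, E) p} (hV : V ∈ horizontalSpace E E' F p)
      (hW : W ∈ horizontalSpace E E' F p) :
      inner ℝ (secondFundamentalForm E E' F p U V) (mfderiv 𝓘(ℝ, E) 𝓘(ℝ, E') F p W) =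
        -inner ℝ (secondFundamentalForm E E' F p U W) (mfderiv 𝓘(ℝ, E) 𝓘(ℝ, E') F p V) := by
    have h₁ := inner_secondFundamentalForm_self hF h p U (add_mem hV hW)
    rw [secondFundamentalForm_add_right hF, map_add, inner_add_left, inner_add_right,
      inner_add_right, inner_secondFundamentalForm_self hF h p U hV,
      inner_secondFundamentalForm_self hF h p U hW] at h₁
    linarith
  have h₁ := skew (U := X) hY hZ
  have h₂ := skew (U := Z) hX hY
  have h₃ := skew (U := Y) hZ hX
  rw [secondFundamentalForm_comm hF p X Z] at h₁
  rw [secondFundamentalForm_comm hF p Z Y] at h₂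
  rw [secondFundamentalForm_comm hF p Y X] at h₃
  linarith

theorem IsRiemannianSubmersion.secondFundamentalForm_eq_zero (hF : IsRiemannianSubmersion E E' F)
    (p : M) {X Y : TangentSpace 𝓘(ℝ, E) p} (hX : X ∈ horizontalSpace E E' F p)
    (hY : Y ∈ horizontalSpace E E' F p) : secondFundamentalForm E E' F p X Y = 0 := by
  obtain ⟨Z, hZ, h⟩ :=
    exists_mem_horizontalSpace (hF.surjective p) (secondFundamentalForm E E' F p X Y)
  have h₀ := inner_secondFundamentalForm_mfderiv hF.smooth hF.isometry p hX hY hZ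
  rw [h] at h₀
  exact inner_self_eq_zero.1 h₀

/-- The mean curvature can be computed in any orthonormal basis of the horizontal space, which is
allowed to be given as an equal submodule `K`. -/
theorem meanCurvature_eq_sum (hF : ContMDiff 𝓘(ℝ, E) 𝓘(ℝ, E') ∞ F) {p : M}
    {K : Submodule ℝ (TangentSpace 𝓘(ℝ, E) p)} (hK : horizontalSpace E E' F p = K)
    {ι : Type*} [Fintype ι] (b : OrthonormalBasis ι ℝ K) :
    meanCurvature E E' F p = (Module.finrank ℝ (rangeSpace E E' F p) : ℝ)⁻¹ •
      ∑ i, secondFundamentalForm E E' F p (b i) (b i) := by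
  subst hK
  exact congrArg _ (sum_bilin_orthonormalBasis_eq
    ((secondFundamentalFormₗ hF p).domRestrict₁₂ (horizontalSpace E E' F p)
      (horizontalSpace E E' F p)) (stdOrthonormalBasis ℝ (horizontalSpace E E' F p)) b)

end HorizontalSecondFundamentalForm

/-! ### A Riemannian submersion followed by an isometric immersion -/

section Composition

variable {E : Type*} [NormedAddCommGroup E] [NormedSpace ℝ E] [FiniteDimensional ℝ E]
  {M : Type*} [TopologicalSpace M] [ChartedSpace E M]
  [RiemannianBundle (fun x : M ↦ TangentSpace 𝓘(ℝ, E) x)]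
  {E' : Type*} [NormedAddCommGroup E'] [NormedSpace ℝ E']
  {N : Type*} [TopologicalSpace N] [ChartedSpace E' N]
  [RiemannianBundle (fun y : N ↦ TangentSpace 𝓘(ℝ, E') y)]
  {E'' : Type*} [NormedAddCommGroup E''] [NormedSpace ℝ E'']
  {P : Type*} [TopologicalSpace P] [ChartedSpace E'' P]
  [RiemannianBundle (fun z : P ↦ TangentSpace 𝓘(ℝ, E'') z)]
  {F : M → N} {G : N → P}

omit [FiniteDimensional ℝ E] in
theorem IsRiemannianSubmersion.comp_isRiemannianMap (hdim : 0 < Module.finrank ℝ E')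
    (hF : IsRiemannianSubmersion E E' F) (hG : IsIsometricImmersion E' E'' G) :
    IsRiemannianMap E E'' (G ∘ F) := by
  refine ⟨hG.smooth.comp hF.smooth, ⟨_, hdim, fun p ↦ ?_⟩, fun p X hX Y hY ↦ ?_⟩
  · rw [rangeSpace_comp hF.smooth hG.smooth (hF.surjective p)]
    exact LinearMap.finrank_range_of_inj (hG.injective (F p))
  · rw [horizontalSpace_comp hF.smooth hG.smooth (hG.injective (F p))] at hX hY
    rw [mfderiv_comp_apply_of_contMDiff hF.smooth hG.smooth,
      mfderiv_comp_apply_of_contMDiff hF.smooth hG.smooth]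
    exact (hG.isometry _ _ _).trans (hF.isometry p X hX Y hY)

variable [FiniteDimensional ℝ E'] [FiniteDimensional ℝ E'']
  [IsManifold 𝓘(ℝ, E) ∞ M] [IsManifold 𝓘(ℝ, E') ∞ N] [IsManifold 𝓘(ℝ, E'') ∞ P]
  [IsContMDiffRiemannianBundle 𝓘(ℝ, E) ∞ E (fun x : M ↦ TangentSpace 𝓘(ℝ, E) x)]
  [IsContMDiffRiemannianBundle 𝓘(ℝ, E') ∞ E' (fun y : N ↦ TangentSpace 𝓘(ℝ, E') y)]
  [IsContMDiffRiemannianBundle 𝓘(ℝ, E'') ∞ E'' (fun z : P ↦ TangentSpace 𝓘(ℝ, E'') z)]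

theorem meanCurvature_comp (hF : IsRiemannianSubmersion E E' F) (hG : IsIsometricImmersion E' E'' G)
    (p : M) : meanCurvature E E'' (G ∘ F) p = meanCurvature E' E'' G (F p) := by
  let b := stdOrthonormalBasis ℝ (horizontalSpace E E' F p)
  rw [meanCurvature_eq_sum (hG.smooth.comp hF.smooth)
      (horizontalSpace_comp hF.smooth hG.smooth (hG.injective (F p))) b,
    meanCurvature_eq_sum hG.smooth (horizontalSpace_eq_top (hG.injective (F p)))
      ((b.map (hF.horizontalEquiv p)).map (LinearIsometryEquiv.ofTop _ ⊤ rfl).symm),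
    rangeSpace_comp hF.smooth hG.smooth (hF.surjective p)]
  refine congrArg _ (Finset.sum_congr rfl fun i _ ↦ ?_)
  rw [secondFundamentalForm_comp hF.smooth hG.smooth,
    hF.secondFundamentalForm_eq_zero p (Subtype.mem _) (Subtype.mem _), map_zero, add_zero]
  rfl

theorem IsPseudoUmbilical.comp (hF : IsRiemannianSubmersion E E' F)
    (hG : IsIsometricImmersion E' E'' G) (hu : IsPseudoUmbilical E' E'' G) :
    IsPseudoUmbilical E E'' (G ∘ F) := by
  obtain ⟨l, hl, hA⟩ := hu
  refine ⟨l ∘ F, hl.comp hF.smooth, fun p X _ ↦ ?_⟩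
  have h := hA (F p) (mfderiv 𝓘(ℝ, E) 𝓘(ℝ, E') F p X)
    (by rw [horizontalSpace_eq_top (hG.injective (F p))]; trivial)
  rw [mfderiv_comp_apply_of_contMDiff hF.smooth hG.smooth, shapeOperator,
    funext (meanCurvature_comp hF hG), covDerivAlong_comp hF.smooth hG.smooth (hF.surjective p)]
  refine Eq.trans ?_ h
  unfold shapeOperator
  congr 3
  exact rangeSpace_comp hF.smooth hG.smooth (hF.surjective p)

end Composition

end RiemannianMap

theorem theorem3p1
    {E₁ : Type*} [NormedAddCommGroup E₁] [NormedSpace ℝ E₁] [FiniteDimensional ℝ E₁]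
    {M₁ : Type*} [TopologicalSpace M₁] [ChartedSpace E₁ M₁] [IsManifold 𝓘(ℝ, E₁) ∞ M₁]
    [Bundle.RiemannianBundle (fun x : M₁ ↦ TangentSpace 𝓘(ℝ, E₁) x)]
    [IsContMDiffRiemannianBundle 𝓘(ℝ, E₁) ∞ E₁ (fun x : M₁ ↦ TangentSpace 𝓘(ℝ, E₁) x)]
    {E₂ : Type*} [NormedAddCommGroup E₂] [NormedSpace ℝ E₂] [FiniteDimensional ℝ E₂]
    {M₂ : Type*} [TopologicalSpace M₂] [ChartedSpace E₂ M₂] [IsManifold 𝓘(ℝ, E₂) ∞ M₂]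
    [Bundle.RiemannianBundle (fun x : M₂ ↦ TangentSpace 𝓘(ℝ, E₂) x)]
    [IsContMDiffRiemannianBundle 𝓘(ℝ, E₂) ∞ E₂ (fun x : M₂ ↦ TangentSpace 𝓘(ℝ, E₂) x)]
    {E₃ : Type*} [NormedAddCommGroup E₃] [NormedSpace ℝ E₃] [FiniteDimensional ℝ E₃]
    {M₃ : Type*} [TopologicalSpace M₃] [ChartedSpace E₃ M₃] [IsManifold 𝓘(ℝ, E₃) ∞ M₃]
    [Bundle.RiemannianBundle (fun x : M₃ ↦ TangentSpace 𝓘(ℝ, E₃) x)]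
    [IsContMDiffRiemannianBundle 𝓘(ℝ, E₃) ∞ E₃ (fun x : M₃ ↦ TangentSpace 𝓘(ℝ, E₃) x)]
    (hdim : 0 < Module.finrank ℝ E₂)
    (F₁ : M₁ → M₂) (F₂ : M₂ → M₃)
    (hF₁ : RiemannianMap.IsRiemannianSubmersion E₁ E₂ F₁)
    (hF₂ : RiemannianMap.IsPseudoUmbilicalIsometricImmersion E₂ E₃ F₂) :
    RiemannianMap.IsPseudoUmbilicalRiemannianMap E₁ E₃ (F₂ ∘ F₁) := by
  exact ⟨hF₁.comp_isRiemannianMap hdim hF₂.1, hF₂.2.comp hF₁ hF₂.1⟩
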